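/- Fiber Pneumoconnectedness Lemma. Let $\mathcal{E}$ be an elementary topos (a category with finite limits that is cartesian closed and has a subobject classifier $\Omega$) satisfying (NS): every object of $\mathcal{E}$ is either initial or has a global element. Write $2 = 1 + 1$, and call an object $Y$ decidable if its diagonal $\Delta_Y \rightarrowtail Y \times Y$ is a complemented subobject. For an object $X$ let $P(X) = \Omega^X$ be its power object and let $P_c(X) \rightarrowtail P(X)$ be the subobject $\{u \in P(X) : u \cup u^c = X\}$, where $u^c = \{x \in X : x \notin u\}$, described in the internal (Mitchell–Bénabou) language of $\mathcal{E}$. For an arrow $f : X \to Y$ with graph $|f| \rightarrowtail X \times Y$ write $f^{-1}(y) = \{x \in X : \langle x, y\rangle \in |f|\}$ for a variable $y$ of type $Y$. Say that $f$ has pneumoconnected fibers if the formula $$\neg\neg\bigl(f^{-1}(y) \cap w = \varnothing \ \vee\ f^{-1}(y) \cap w^c = \varnothing\bigr)$$ is universally valid in the internal language of $\mathcal{E}$, with $y \in Y$ and $w \in P_c(X)$. Let $q : X \to Q$ be an epimorphism in $\mathcal{E}$. Then the following statements are equivalent: (i) every arrow $X \to 2$ factors through $q$; (ii) $q$ has pneumoconnected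 fibers; (iii) every arrow $X \to Y$ with $Y$ decidable factors through $q$. -/

import Mathlib

universe v u

open CategoryTheory CategoryTheory.Limits

namespace ToposFibers

noncomputable section

open MonoidalCategory CartesianMonoidalCategory HasSubobjectClassifier

set_option linter.unusedSectionVars false

/- Throughout, `C` is an elementary topos: a category with finite limits that is cartesian closed
and has a subobject classifier. -/

variable {C : Type u} [Category.{v} C] [HasFiniteLimits C] [CartesianMonoidalCategory C]
  [MonoidalClosed C] [HasSubobjectClassifier C]

/-- The subobject `{x | φ x}` classified by `φ`. -/
def sub {A : C} (φ : A ⟶ Ω C) : Subobject A :=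
  (Subobject.pullback φ).obj (Subobject.mk (truth C))

theorem sub_isPullback {A : C} (φ : A ⟶ Ω C) :
    ∃ t, IsPullback (sub φ).arrow t φ (truth C) := by
  have h := (Subobject.isPullback φ (Subobject.mk (truth C))).flip
  exact ⟨_, h.of_iso (Iso.refl _) (Iso.refl _) (Subobject.underlyingIso _) (Iso.refl _)
    (by simp [sub]) (Category.id_comp _).symm (by simp) (by simp)⟩

theorem chi_sub {A : C} (φ : A ⟶ Ω C) : χ (sub φ).arrow = φ :=
  Subobject.Classifier.χ_pullback_obj_mk_truth_arrow _ φ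

/-- Direct image of a predicate along a mono. -/
def dirIm {A B : C} (m : A ⟶ B) [Mono m] (φ : A ⟶ Ω C) : B ⟶ Ω C :=
  χ ((sub φ).arrow ≫ m)

theorem comp_dirIm {U' V' U V : C} {t : U' ⟶ U} {m' : U' ⟶ V'} {m : U ⟶ V} {b : V' ⟶ V}
    [Mono m] [Mono m'] (sq : IsPullback t m' m b) (φ : U ⟶ Ω C) :
    b ≫ dirIm m φ = dirIm m' (t ≫ φ) := by
  obtain ⟨τ, h⟩ := sub_isPullback φ
  obtain ⟨τ', h'⟩ := sub_isPullback (t ≫ φ)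
  have k := IsPullback.of_right' h'.flip h.flip
  exact Subobject.Classifier.uniq _ _
    ((k.paste_vert sq).flip.paste_vert (isPullback_χ ((sub φ).arrow ≫ m)))

theorem dirIm_id {A : C} (φ : A ⟶ Ω C) : dirIm (𝟙 A) φ = φ := by
  conv_rhs => rw [← chi_sub φ]
  unfold dirIm
  congr 1
  simp

instance {A B : C} (m : A ⟶ B) [Mono m] (Z : C) : Mono (m ▷ Z) where
  right_cancellation g h w := by
    apply CartesianMonoidalCategory.hom_ext
    · rw [← cancel_mono m]
      simpa using w =≫ fst _ _
    · simpa using w =≫ snd _ _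

theorem whisker_isPullback {A B D E : C} {t : D ⟶ A} {m' : D ⟶ E} {m : A ⟶ B} {b : E ⟶ B}
    (sq : IsPullback t m' m b) (Z : C) : IsPullback (t ▷ Z) (m' ▷ Z) (m ▷ Z) (b ▷ Z) := by
  refine IsPullback.mk' ?_ ?_ ?_
  · simp only [← comp_whiskerRight, sq.w]
  · intro T φ φ' h₁ h₂
    apply CartesianMonoidalCategory.hom_ext
    · apply sq.hom_ext
      · simpa using h₁ =≫ fst _ _
      · simpa using h₂ =≫ fst _ _
    · simpa using h₁ =≫ snd _ _
  · intro T x y w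
    have w₁ : (x ≫ fst _ _) ≫ m = (y ≫ fst _ _) ≫ b := by simpa using w =≫ fst _ _
    have w₂ : x ≫ snd _ _ = y ≫ snd _ _ := by simpa using w =≫ snd _ _
    refine ⟨lift (sq.lift _ _ w₁) (x ≫ snd _ _), ?_, ?_⟩
    · apply CartesianMonoidalCategory.hom_ext <;> simp
    · apply CartesianMonoidalCategory.hom_ext <;> simp [w₂]

theorem exchange_isPullback {A B : C} (m : A ⟶ B) {Z W : C} (k : Z ⟶ W) :
    IsPullback (A ◁ k) (m ▷ Z) (m ▷ W) (B ◁ k) := by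
  refine IsPullback.mk' ?_ ?_ ?_
  · exact (whisker_exchange m k)
  · intro T φ φ' h₁ h₂
    apply CartesianMonoidalCategory.hom_ext
    · simpa using h₁ =≫ fst _ _
    · simpa using h₂ =≫ snd _ _
  · intro T x y w
    have w₁ : (x ≫ fst _ _) ≫ m = (y ≫ fst _ _) := by simpa using w =≫ fst _ _
    have w₂ : x ≫ snd _ _ = (y ≫ snd _ _) ≫ k := by simpa using w =≫ snd _ _
    refine ⟨lift (x ≫ fst _ _) (y ≫ snd _ _), ?_, ?_⟩
    · apply CartesianMonoidalCategory.hom_ext <;> simp [w₂]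
    · apply CartesianMonoidalCategory.hom_ext <;> simp [← w₁]

/-- The power object `Ω ^ X`. -/
abbrev Pow (X : C) : C := (ihom X).obj (Ω C)

/- The next declarations, up to the instance of finite colimits, construct finite colimits in a
topos by means of the monadicity of the contravariant power object functor. -/

variable (C) in
/-- The contravariant power object functor, sending `f` to inverse image along `f`. -/
def powFunctor : Cᵒᵖ ⥤ C := MonoidalClosed.internalHom.flip.obj (Ω C)

theorem powFunctor_map {A B : C} (f : A ⟶ B) :
    (powFunctor C).map f.op = (MonoidalClosed.pre f).app (Ω C) := rfl

/-- Direct image `Pow A ⟶ Pow B` along a mono `A ⟶ B`. -/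
def powIm {A B : C} (m : A ⟶ B) [Mono m] : Pow A ⟶ Pow B :=
  MonoidalClosed.curry (dirIm (m ▷ Pow A) ((ihom.ev A).app (Ω C)))

/-- Beck-Chevalley condition. -/
theorem powIm_comp_pre {A B D E : C} {t : D ⟶ A} {m' : D ⟶ E} {m : A ⟶ B} {b : E ⟶ B}
    [Mono m] [Mono m'] (sq : IsPullback t m' m b) :
    powIm m ≫ (MonoidalClosed.pre b).app (Ω C) = (MonoidalClosed.pre t).app (Ω C) ≫ powIm m' := by
  unfold powIm
  rw [MonoidalClosed.curry_pre_app, comp_dirIm (whisker_isPullback sq _),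
    ← MonoidalClosed.curry_natural_left, comp_dirIm (exchange_isPullback m' _),
    MonoidalClosed.id_tensor_pre_app_comp_ev]

theorem powIm_id (A : C) : powIm (𝟙 A) = 𝟙 (Pow A) := by
  have : dirIm (𝟙 A ▷ Pow A) ((ihom.ev A).app (Ω C)) = (ihom.ev A).app (Ω C) := by
    conv_rhs => rw [← dirIm_id ((ihom.ev A).app (Ω C))]
    congr 1
    simp
  unfold powIm
  rw [this, ← MonoidalClosed.uncurry_id_eq_ev, MonoidalClosed.curry_uncurry]

theorem powIm_comp_pre_self {A B : C} (m : A ⟶ B) [Mono m] :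
    powIm m ≫ (MonoidalClosed.pre m).app (Ω C) = 𝟙 (Pow A) := by
  have sq : IsPullback (𝟙 A) (𝟙 A) m m := IsPullback.of_horiz_isIso_mono ⟨rfl⟩
  rw [powIm_comp_pre sq, powIm_id, MonoidalClosed.pre_id]
  exact Category.comp_id _

/-- The symmetry of the binary product. -/
def swap (A B : C) : A ⊗ B ⟶ B ⊗ A := lift (snd A B) (fst A B)

@[simp]
theorem swap_swap_assoc {A B Z : C} (h : A ⊗ B ⟶ Z) : swap A B ≫ swap B A ≫ h = h := by
  rw [← Category.assoc]
  have : swap A B ≫ swap B A = 𝟙 _ := by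
    apply CartesianMonoidalCategory.hom_ext <;> simp [swap]
  rw [this, Category.id_comp]

theorem whiskerRight_swap {A A' B : C} (f : A ⟶ A') :
    f ▷ B ≫ swap A' B = swap A B ≫ B ◁ f := by
  apply CartesianMonoidalCategory.hom_ext <;> simp [swap]

theorem whiskerLeft_swap {A A' B : C} (f : A ⟶ A') :
    B ◁ f ≫ swap B A' = swap B A ≫ f ▷ B := by
  apply CartesianMonoidalCategory.hom_ext <;> simp [swap]

/-- Exchange the two variables of a relation. -/
def flipPow {A B : C} (g : B ⟶ Pow A) : A ⟶ Pow B :=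
  MonoidalClosed.curry (swap B A ≫ MonoidalClosed.uncurry g)

theorem flipPow_flipPow {A B : C} (g : B ⟶ Pow A) : flipPow (flipPow g) = g := by
  simp [flipPow]

theorem flipPow_comp {A A' B : C} (f : A' ⟶ A) (h : A ⟶ Pow B) :
    flipPow (f ≫ h) = flipPow h ≫ (MonoidalClosed.pre f).app (Ω C) := by
  unfold flipPow
  rw [MonoidalClosed.curry_pre_app, MonoidalClosed.uncurry_natural_left, ← Category.assoc,
    ← whiskerRight_swap, Category.assoc]

variable (C) in
/-- The power object functor is self-adjoint on the right. -/
def powAdj : (powFunctor C).rightOp ⊣ powFunctor C :=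
  Adjunction.mkOfHomEquiv
    { homEquiv := fun A B =>
        { toFun := fun g => flipPow (A := A) (B := B.unop) g.unop
          invFun := fun h => (flipPow (A := B.unop) (B := A) h).op
          left_inv := fun g => Quiver.Hom.unop_inj (flipPow_flipPow g.unop)
          right_inv := fun h => flipPow_flipPow h }
      homEquiv_naturality_left_symm := fun f h => Quiver.Hom.unop_inj (flipPow_comp f h)
      homEquiv_naturality_right := fun g k => flipPow_comp k.unop g.unop }

instance {X Y : C} (f : X ⟶ Y) : Mono (lift (𝟙 X) f) where
  right_cancellation g h w := by simpa using w =≫ fst _ _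

instance : (powFunctor C).Faithful where
  map_injective {X Y} f g w := by
    have w' : (MonoidalClosed.pre f.unop).app (Ω C) = (MonoidalClosed.pre g.unop).app (Ω C) := w
    have h := congrArg (fun t => MonoidalClosed.curry (χ (lift (𝟙 X.unop) (𝟙 X.unop))) ≫ t) w'
    simp only [MonoidalClosed.curry_pre_app] at h
    have h₁ := congrArg (fun t => lift (𝟙 Y.unop) f.unop ≫ t) (MonoidalClosed.curry_injective h)
    have e₁ : lift (𝟙 Y.unop) f.unop ≫ f.unop ▷ X.unop = f.unop ≫ lift (𝟙 _) (𝟙 _) := by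
      apply CartesianMonoidalCategory.hom_ext <;> simp
    have e₂ : lift (𝟙 Y.unop) f.unop ≫ g.unop ▷ X.unop = lift g.unop f.unop := by
      apply CartesianMonoidalCategory.hom_ext <;> simp
    simp only [← Category.assoc, e₁, e₂] at h₁
    rw [Category.assoc, HasSubobjectClassifier.comm, ← Category.assoc] at h₁
    have pb := isPullback_χ (lift (𝟙 X.unop) (𝟙 X.unop))
    have l := pb.lift_fst _ _ h₁.symm
    have l₁ := l =≫ fst _ _
    have l₂ := l =≫ snd _ _
    simp only [Category.assoc, lift_fst, lift_snd, Category.comp_id] at l₁ l₂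
    exact Quiver.Hom.unop_inj (l₂.symm.trans l₁)

instance : Monad.PreservesColimitOfIsReflexivePair (powFunctor C) where
  out A B f g _ := by
    have e : IsPullback (coequalizer.π f g).unop (coequalizer.π f g).unop g.unop f.unop := by
      have hr : f.unop ≫ (commonSection f g).unop = g.unop ≫ (commonSection f g).unop := by
        simp [← unop_comp]
      have hs : f.unop ≫ (commonSection f g).unop = 𝟙 _ := by
        simp [← unop_comp]
      refine IsPullback.mk' ?_ ?_ ?_
      · exact congrArg Quiver.Hom.unop (coequalizer.condition f g).symm
      · intro T a b h _
        exact Quiver.Hom.op_inj ((cancel_epi (coequalizer.π f g)).mp (Quiver.Hom.unop_inj h))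
      · intro T a b h
        have hab : a = b := by
          have := h =≫ (commonSection f g).unop
          rw [Category.assoc, Category.assoc, ← hr, hs] at this
          simpa using this
        subst hab
        have hc : f ≫ a.op = g ≫ a.op := Quiver.Hom.unop_inj h.symm
        have hd := congrArg Quiver.Hom.unop (coequalizer.π_desc a.op hc)
        exact ⟨(coequalizer.desc a.op hc).unop, hd, hd⟩
    have : Mono g.unop := by
      have hs : g.unop ≫ (commonSection f g).unop = 𝟙 _ := by
        simp [← unop_comp]
      exact ⟨fun a b h => by
        have := h =≫ (commonSection f g).unop
        simpa only [Category.assoc, hs, Category.comp_id] using this⟩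
    refine preservesColimit_of_preserves_colimit_cocone (coequalizerIsCoequalizer f g) ?_
    refine (isColimitMapCoconeCoforkEquiv _ _).symm ?_
    refine IsSplitCoequalizer.isCoequalizer
      { rightSection := powIm (coequalizer.π f g).unop
        leftSection := powIm g.unop
        condition := by
          have := congrArg (powFunctor C).map (coequalizer.condition f g)
          rwa [Functor.map_comp, Functor.map_comp] at this
        rightSection_π := powIm_comp_pre_self _
        leftSection_bottom := powIm_comp_pre_self _
        leftSection_top := powIm_comp_pre e }

instance (priority := 100) : HasFiniteColimits C := by
  let : MonadicRightAdjoint (powFunctor C) :=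
    Monad.monadicOfHasPreservesReflexiveCoequalizersOfReflectsIsomorphisms (powAdj C)
  let : CreatesLimitsOfSize.{0, 0} (powFunctor C) := monadicCreatesLimits _
  have : HasFiniteLimits Cᵒᵖ := ⟨fun J _ _ =>
    hasLimitsOfShape_of_hasLimitsOfShape_createsLimitsOfShape (powFunctor C)⟩
  exact hasFiniteLimits_opposite_iff.mp this

theorem imageAux {X Y : C} (f : X ⟶ Y) (F' : MonoFactorisation f) :
    ∃ l, l ≫ F'.m = equalizer.ι (pushout.inl f f) (pushout.inr f f) := by
  have := IsRegularMonoCategory.regularMonoOfMono F'.m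
  have w : f ≫ IsRegularMono.left F'.m = f ≫ IsRegularMono.right F'.m := by
    have h := F'.e ≫= IsRegularMono.w F'.m
    rwa [← Category.assoc, ← Category.assoc, F'.fac] at h
  exact ⟨IsRegularMono.lift F'.m _ (by
    have h := equalizer.condition (pushout.inl f f) (pushout.inr f f) =≫ pushout.desc _ _ w
    rwa [Category.assoc, Category.assoc, pushout.inl_desc, pushout.inr_desc] at h),
    IsRegularMono.fac _ _ _⟩

/-- The image factorization of `f`, through the equalizer of its cokernel pair. -/
instance (priority := 100) : HasImages C where
  has_image {X Y} f := HasImage.mk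
    { F :=
        { I := equalizer (pushout.inl f f) (pushout.inr f f)
          m := equalizer.ι _ _
          e := equalizer.lift f pushout.condition }
      isImage :=
        { lift := fun F' => (imageAux f F').choose
          lift_fac := fun F' => (imageAux f F').choose_spec } }

instance (priority := 100) : InitialMonoClass C :=
  InitialMonoClass.of_isInitial initialIsInitial fun X => Initial.mono_to X

/-- Formulas of the internal language in context `Γ` are interpreted as subobjects of `Γ`, terms of
type `X` as arrows `Γ ⟶ X`. Truth is `⊤`, absurdity is `⊥`, conjunction is `⊓` and disjunction is
`⊔` in the lattice `Subobject Γ`. -/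
abbrev Formula (Γ : C) := Subobject Γ

/-- A formula is universally valid if it is interpreted as the maximal subobject. -/
def Formula.Valid {Γ : C} (φ : Formula Γ) : Prop := φ = ⊤

variable (C) in
/-- The truth value `false`, the characteristic map of `0 ⟶ 1`. -/
def falsum : Ω₀ C ⟶ Ω C := χ (initial.to (Ω₀ C))

instance : Mono (falsum C) where
  right_cancellation _ _ _ := Subsingleton.elim _ _

/-- Negation of formulas: `¬ φ` holds where the truth value of `φ` is `false`. -/
def Formula.neg {Γ : C} (φ : Formula Γ) : Formula Γ :=
  (Subobject.pullback (χ φ.arrow)).obj (Subobject.mk (falsum C))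

/-- The formula `s = t`, for terms `s` and `t` of the same type. -/
def eqF {Γ X : C} (s t : Γ ⟶ X) : Formula Γ := equalizerSubobject s t

/-- The formula `t ∈ u`, for terms `t` of type `X` and `u` of type `Pow X`. -/
def memF {Γ X : C} (t : Γ ⟶ X) (u : Γ ⟶ Pow X) : Formula Γ :=
  sub (lift t u ≫ (ihom.ev X).app (Ω C))

/-- The term `{x ∈ X | φ (x, γ)}` of type `Pow X`. -/
def setOfT {Γ X : C} (φ : Formula (X ⊗ Γ)) : Γ ⟶ Pow X := MonoidalClosed.curry (χ φ.arrow)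

/-- The term `∅` of type `Pow X`. -/
def emptyT (Γ X : C) : Γ ⟶ Pow X := setOfT ⊥

/-- The term `X` (the whole of `X`) of type `Pow X`. -/
def univT (Γ X : C) : Γ ⟶ Pow X := setOfT ⊤

/-- The term `u ∩ w = {x | x ∈ u ∧ x ∈ w}`. -/
def interT {Γ X : C} (u w : Γ ⟶ Pow X) : Γ ⟶ Pow X :=
  setOfT (memF (fst X Γ) (snd X Γ ≫ u) ⊓ memF (fst X Γ) (snd X Γ ≫ w))

/-- The term `u ∪ w = {x | x ∈ u ∨ x ∈ w}`. -/
def unionT {Γ X : C} (u w : Γ ⟶ Pow X) : Γ ⟶ Pow X :=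
  setOfT (memF (fst X Γ) (snd X Γ ≫ u) ⊔ memF (fst X Γ) (snd X Γ ≫ w))

/-- The term `uᶜ = {x | ¬ (x ∈ u)}`. -/
def complT {Γ X : C} (u : Γ ⟶ Pow X) : Γ ⟶ Pow X :=
  setOfT (memF (fst X Γ) (snd X Γ ≫ u)).neg

/-- The object of complemented subobjects of `X`, as the subobject `{u | u ∪ uᶜ = X}` of `Pow X`. -/
def powCompl (X : C) : Subobject (Pow X) :=
  eqF (unionT (𝟙 (Pow X)) (complT (𝟙 (Pow X)))) (univT (Pow X) X)

/-- The graph of an arrow. -/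
def graph {X Y : C} (f : X ⟶ Y) : Subobject (X ⊗ Y) := Subobject.mk (lift (𝟙 X) f)

/-- The fiber `f⁻¹(y) = {x ∈ X | (x, y) ∈ |f|}` over a term `y` of type `Y`, where `|f|` is the
graph of `f`. -/
def fiberT {Γ X Y : C} (f : X ⟶ Y) (y : Γ ⟶ Y) : Γ ⟶ Pow X :=
  setOfT ((Subobject.pullback (lift (fst X Γ) (snd X Γ ≫ y))).obj (graph f))

/-- `f` has pneumoconnected fibers: `¬¬ (f⁻¹(y) ∩ w = ∅ ∨ f⁻¹(y) ∩ wᶜ = ∅)` is universally valid,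
where `y` is of type `Y` and `w` of type `powCompl X`. -/
def PneumoconnectedFibers {X Y : C} (f : X ⟶ Y) : Prop :=
  let Γ : C := Y ⊗ (powCompl X : C)
  let y : Γ ⟶ Y := fst _ _
  let w : Γ ⟶ Pow X := snd _ _ ≫ (powCompl X).arrow
  (eqF (interT (fiberT f y) w) (emptyT Γ X) ⊔
    eqF (interT (fiberT f y) (complT w)) (emptyT Γ X)).neg.neg.Valid

/-- `Y` is decidable if its diagonal is a complemented subobject of `Y × Y`. -/
def IsDecidable (Y : C) : Prop := IsComplemented (Subobject.mk (lift (𝟙 Y) (𝟙 Y)))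

variable (C) in
/-- The object `2 = 1 + 1`. -/
def two : C := 𝟙_ C ⨿ 𝟙_ C

variable (C) in
/-- The axiom NS: any object is either initial or has a global element. -/
def Nullstellensatz : Prop := ∀ X : C, Nonempty (IsInitial X) ∨ Nonempty (𝟙_ C ⟶ X)

end

end ToposFibers

namespace ToposFibers

noncomputable section

open MonoidalCategory CartesianMonoidalCategory HasSubobjectClassifier

set_option linter.unusedSectionVars false

variable {C : Type u} [Category.{v} C] [HasFiniteLimits C] [CartesianMonoidalCategory C]
  [MonoidalClosed C] [HasSubobjectClassifier C]

/-! ### Subobjects through generalized elements -/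

/-! Under NS the internal statement can be read on global elements. A subobject of `1` either is
initial or has a point, so at a global element every formula holds or its negation does, and a
disjunction holds only if a disjunct does; moreover `¬¬P` is valid exactly when `P` holds at every
global element (`Nullstellensatz.neg_neg_valid_iff`). Pneumoconnectedness thus says that the fiber
over each `y : 1 ⟶ Q` misses `W` or its complement, for every complemented `W` in `X`
(`Nullstellensatz.pneumoconnectedFibers_iff`).

(i) ⇒ (ii): `W` is cut out by an arrow `X ⟶ 2`; once it factors through `q` it is constant on the
fiber over `y`. (ii) ⇒ (iii): an epimorphism is the coequalizer of its kernel pair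
(`exists_factor_of_epi`), so it suffices that `f` identify what `q` identifies. As `Y` is decidable,
a failure would, by NS, occur at points `x₁`, `x₂` of one fiber with `f x₁ ≠ f x₂`, and then the
complemented subobject `{x | f x = f x₁}` separates that fiber. (iii) ⇒ (i): `2` is decidable.

Arguments about subobjects are carried out on generalized elements, with `factors_of_sup_eq_top` for
case distinctions and `neg_factors_iff` for negation. -/

theorem le_iff_factors {A : C} {P R : Subobject A} :
    P ≤ R ↔ ∀ ⦃T : C⦄ (t : T ⟶ A), P.Factors t → R.Factors t :=
  ⟨fun h _ t ht => Subobject.factors_of_le t h ht,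
    fun h => Subobject.le_of_factors (h _ P.factors_self)⟩

theorem eq_iff_factors {A : C} {P R : Subobject A} :
    P = R ↔ ∀ ⦃T : C⦄ (t : T ⟶ A), P.Factors t ↔ R.Factors t :=
  ⟨fun h _ _ => by rw [h], fun h => le_antisymm (le_iff_factors.2 fun _ t => (h t).1)
    (le_iff_factors.2 fun _ t => (h t).2)⟩

theorem eq_top_iff_factors {A : C} {P : Subobject A} :
    P = ⊤ ↔ ∀ ⦃T : C⦄ (t : T ⟶ A), P.Factors t :=
  ⟨fun h _ t => h ▸ Subobject.top_factors t,
    fun h => top_le_iff.1 (le_iff_factors.2 fun _ t _ => h t)⟩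

theorem eq_top_iff_factors_id {A : C} {P : Subobject A} : P = ⊤ ↔ P.Factors (𝟙 A) :=
  ⟨fun h => eq_top_iff_factors.1 h _, fun h => eq_top_iff_factors.2 fun _ t => by
    simpa using Subobject.factors_of_factors_right t h⟩

theorem pullback_factors_iff {A B T : C} (f : A ⟶ B) (P : Subobject B) (t : T ⟶ A) :
    ((Subobject.pullback f).obj P).Factors t ↔ P.Factors (t ≫ f) := by
  have pb := Subobject.isPullback f P
  constructor
  · intro h
    rw [← Subobject.factorThru_arrow _ t h, Category.assoc, ← pb.w, ← Category.assoc]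
    exact Subobject.factors_comp_arrow _
  · intro h
    rw [← pb.lift_snd (P.factorThru _ h) t (Subobject.factorThru_arrow _ _ h)]
    exact Subobject.factors_comp_arrow _

theorem mk_factors_iff_exists {A B T : C} (m : A ⟶ B) [Mono m] (t : T ⟶ B) :
    (Subobject.mk m).Factors t ↔ ∃ s, s ≫ m = t := Iff.rfl

theorem factors_iff_exists {B T : C} (P : Subobject B) (t : T ⟶ B) :
    P.Factors t ↔ ∃ s, s ≫ P.arrow = t :=
  ⟨fun h => ⟨P.factorThru t h, P.factorThru_arrow t h⟩, fun ⟨s, h⟩ => h ▸ P.factors_comp_arrow s⟩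

theorem sub_chi_mk {A B : C} (m : A ⟶ B) [Mono m] : sub (χ m) = Subobject.mk m :=
  Subobject.Classifier.pullback_χ_obj_mk_truth
    (HasSubobjectClassifier.exists_classifier (C := C)).some m

theorem sub_chi {A : C} (P : Subobject A) : sub (χ P.arrow) = P := by
  rw [sub_chi_mk, Subobject.mk_arrow]

theorem sub_factors_iff {A T : C} (φ : A ⟶ Ω C) (t : T ⟶ A) :
    (sub φ).Factors t ↔ (sub (t ≫ φ)).Factors (𝟙 T) := by
  simp only [sub, pullback_factors_iff, Category.id_comp]

theorem sub_injective {A : C} {φ ψ : A ⟶ Ω C} (h : sub φ = sub ψ) : φ = ψ := by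
  rw [← chi_sub φ, ← chi_sub ψ, h]

theorem chi_arrow_injective {A : C} {P R : Subobject A} (h : χ P.arrow = χ R.arrow) : P = R := by
  rw [← sub_chi P, ← sub_chi R, h]

theorem comp_chi_arrow {A B : C} (f : A ⟶ B) (P : Subobject B) :
    f ≫ χ P.arrow = χ ((Subobject.pullback f).obj P).arrow := by
  apply sub_injective
  rw [sub_chi, sub, Subobject.pullback_comp]
  exact congrArg _ (sub_chi P)

theorem mk_graph_factors_iff {A B T : C} (f : A ⟶ B) (a : T ⟶ A) (b : T ⟶ B) :
    (Subobject.mk (lift (𝟙 A) f)).Factors (lift a b) ↔ a ≫ f = b := by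
  rw [mk_factors_iff_exists]
  constructor
  · rintro ⟨s, hs⟩
    have h₁ := hs =≫ fst _ _
    have h₂ := hs =≫ snd _ _
    simp only [Category.assoc, lift_fst, lift_snd, Category.comp_id] at h₁ h₂
    rw [← h₁, h₂]
  · rintro rfl
    exact ⟨a, by simp⟩

/-- The universal quantifier along `f`. -/
theorem exists_forall_subobject {A B : C} (f : A ⟶ B) (D : Subobject A) :
    ∃ D' : Subobject B, ∀ E, (Subobject.pullback f).obj E ≤ D ↔ E ≤ D' := by
  let G : Subobject (A ⊗ B) := Subobject.mk (lift (𝟙 A) f)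
  have hG {T : C} (a : T ⟶ A) (b : T ⟶ B) : G.Factors (lift a b) ↔ a ≫ f = b :=
    mk_graph_factors_iff f a b
  let G' : Subobject (A ⊗ B) := G ⊓ (Subobject.pullback (fst A B)).obj D
  -- The witness is `{b | f⁻¹(b) = f⁻¹(b) ∩ D}`: `G` is the graph of `f`, `G'` its restriction to
  -- `D`, and both are curried to families of subobjects of `A` indexed by `B`.
  refine ⟨equalizerSubobject (MonoidalClosed.curry (χ G.arrow))
    (MonoidalClosed.curry (χ G'.arrow)), fun E => ?_⟩
  have key {T : C} (t : T ⟶ B) :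
      t ≫ MonoidalClosed.curry (χ G.arrow) = t ≫ MonoidalClosed.curry (χ G'.arrow) ↔
        ∀ ⦃S : C⦄ (a : S ⟶ A) (b : S ⟶ T), a ≫ f = b ≫ t → D.Factors a := by
    rw [← MonoidalClosed.curry_natural_left, ← MonoidalClosed.curry_natural_left,
      MonoidalClosed.curry_injective.eq_iff, comp_chi_arrow, comp_chi_arrow]
    constructor
    · intro h S a b hab
      have := eq_iff_factors.1 (chi_arrow_injective h) (lift a b)
      simp only [pullback_factors_iff, lift_whiskerLeft, G', Subobject.inf_factors, hG, lift_fst]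
        at this
      exact (this.1 hab).2
    · intro h
      suffices e : (Subobject.pullback (A ◁ t)).obj G = (Subobject.pullback (A ◁ t)).obj G' by
        rw [e]
      refine eq_iff_factors.2 fun S s => ?_
      obtain ⟨a, b, rfl⟩ : ∃ a b, s = lift a b := ⟨s ≫ fst _ _, s ≫ snd _ _, by simp⟩
      simp only [pullback_factors_iff, lift_whiskerLeft, G', Subobject.inf_factors, hG, lift_fst]
      exact ⟨fun hab => ⟨hab, h a b hab⟩, And.left⟩
  rw [le_iff_factors, le_iff_factors]
  simp only [equalizerSubobject_factors_iff, key, pullback_factors_iff]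
  constructor
  · intro h T t ht S a b hab
    exact h a (hab ▸ Subobject.factors_of_factors_right b ht)
  · intro h T t ht
    exact h _ ht t (𝟙 T) (by simp)

/-- Inverse image has a right adjoint, the universal quantifier along `f`, and so preserves joins.
-/
theorem pullback_sup {A B : C} (f : A ⟶ B) (P R : Subobject B) :
    (Subobject.pullback f).obj (P ⊔ R) =
      (Subobject.pullback f).obj P ⊔ (Subobject.pullback f).obj R := by
  have mono : Monotone (Subobject.pullback f).obj := (Subobject.pullback f).monotone
  refine le_antisymm ?_ (sup_le (mono le_sup_left) (mono le_sup_right))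
  obtain ⟨D', h⟩ := exists_forall_subobject f
    ((Subobject.pullback f).obj P ⊔ (Subobject.pullback f).obj R)
  exact (h _).2 (sup_le ((h P).1 le_sup_left) ((h R).1 le_sup_right))

theorem sup_factors_iff {A T : C} (P R : Subobject A) (t : T ⟶ A) :
    (P ⊔ R).Factors t ↔
      (Subobject.pullback t).obj P ⊔ (Subobject.pullback t).obj R = ⊤ := by
  rw [← pullback_sup, eq_top_iff_factors_id, pullback_factors_iff, Category.id_comp]

/-- Reasoning by cases on a cover by two subobjects. -/
theorem factors_of_sup_eq_top {A B T : C} {P R : Subobject A} (h : P ⊔ R = ⊤) (x : T ⟶ A)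
    {D : Subobject B} (t : T ⟶ B)
    (hP : ∀ ⦃S : C⦄ (s : S ⟶ T), P.Factors (s ≫ x) → D.Factors (s ≫ t))
    (hR : ∀ ⦃S : C⦄ (s : S ⟶ T), R.Factors (s ≫ x) → D.Factors (s ≫ t)) : D.Factors t := by
  have h' : (Subobject.pullback x).obj P ⊔ (Subobject.pullback x).obj R = ⊤ := by
    rw [← pullback_sup, h, Subobject.pullback_top]
  have : (Subobject.pullback t).obj D = ⊤ := by
    rw [← top_le_iff, ← h']
    refine sup_le ?_ ?_ <;> rw [le_iff_factors] <;> intro S s hs <;>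
      rw [pullback_factors_iff] at hs ⊢
    exacts [hP s hs, hR s hs]
  simpa [pullback_factors_iff] using eq_top_iff_factors_id.1 this

theorem eq_of_sup_eq_top {A B T : C} {P R : Subobject A} (h : P ⊔ R = ⊤) (x : T ⟶ A)
    {f g : T ⟶ B} (hP : ∀ ⦃S : C⦄ (s : S ⟶ T), P.Factors (s ≫ x) → s ≫ f = s ≫ g)
    (hR : ∀ ⦃S : C⦄ (s : S ⟶ T), R.Factors (s ≫ x) → s ≫ f = s ≫ g) : f = g := by
  have := factors_of_sup_eq_top (D := equalizerSubobject f g) h x (𝟙 T)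
  simp only [equalizerSubobject_factors_iff, Category.comp_id, Category.id_comp] at this
  exact this hP hR

/-! ### Initial objects -/

theorem isIso_of_hom_initial {A : C} (f : A ⟶ ⊥_ C) : IsIso f :=
  strict_initial initialIsInitial f

theorem eq_of_hom_initial {A B : C} (e : A ⟶ ⊥_ C) (f g : A ⟶ B) : f = g := by
  have := isIso_of_hom_initial e
  rw [← cancel_epi (inv e)]
  exact Subsingleton.elim _ _

theorem bot_factors_iff {A T : C} (t : T ⟶ A) :
    (⊥ : Subobject A).Factors t ↔ Nonempty (T ⟶ ⊥_ C) := by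
  rw [Subobject.bot_eq_initial_to, mk_factors_iff_exists]
  exact ⟨fun ⟨s, _⟩ => ⟨s⟩, fun ⟨s⟩ => ⟨s, eq_of_hom_initial s _ _⟩⟩

theorem factors_of_hom_initial {A T : C} (e : T ⟶ ⊥_ C) (P : Subobject A) (t : T ⟶ A) :
    P.Factors t :=
  Subobject.factors_of_le t bot_le ((bot_factors_iff t).2 ⟨e⟩)

theorem eq_bot_iff_factors {A : C} {P : Subobject A} :
    P = ⊥ ↔ ∀ ⦃T : C⦄ (t : T ⟶ A), P.Factors t → Nonempty (T ⟶ ⊥_ C) := by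
  rw [← le_bot_iff, le_iff_factors]
  simp only [bot_factors_iff]

/-! ### Negation -/

theorem falsum_eq : falsum C = χ (⊥ : Subobject (Ω₀ C)).arrow :=
  sub_injective (by rw [falsum, sub_chi_mk, sub_chi, Subobject.bot_eq_initial_to])

/-- The Kripke–Joyal clause for negation: the truth value of `P` at `t` is `false` exactly when the
pullback of `P` along `t` is `⊥`, and only stages over the strict initial object factor through `⊥`.
-/
theorem neg_factors_iff {A T : C} (P : Formula A) (t : T ⟶ A) :
    P.neg.Factors t ↔ ∀ ⦃S : C⦄ (s : S ⟶ T), P.Factors (s ≫ t) → Nonempty (S ⟶ ⊥_ C) := by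
  rw [Formula.neg, pullback_factors_iff, mk_factors_iff_exists, falsum_eq]
  constructor
  · rintro ⟨r, hr⟩ S s hs
    rw [comp_chi_arrow, comp_chi_arrow] at hr
    have := eq_iff_factors.1 (chi_arrow_injective hr) s
    rw [pullback_factors_iff, pullback_factors_iff, bot_factors_iff] at this
    exact this.2 hs
  · intro h
    refine ⟨Subobject.Classifier.χ₀ _ T, ?_⟩
    rw [comp_chi_arrow, comp_chi_arrow]
    suffices e : (Subobject.pullback (Subobject.Classifier.χ₀ _ T)).obj ⊥ =
        (Subobject.pullback t).obj P by
      rw [e]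
    refine eq_iff_factors.2 fun S s => ?_
    rw [pullback_factors_iff, pullback_factors_iff, bot_factors_iff]
    exact ⟨fun ⟨e⟩ => factors_of_hom_initial e _ _, h s⟩

theorem pullback_neg {A B : C} (f : A ⟶ B) (P : Formula B) :
    (Subobject.pullback f).obj P.neg = Formula.neg ((Subobject.pullback f).obj P) := by
  refine eq_iff_factors.2 fun T t => ?_
  simp only [pullback_factors_iff, neg_factors_iff, Category.assoc]

/-- Lets the lattice complement supplied by `IsDecidable` be replaced by internal negation, which is
stable under pullback. -/
theorem neg_eq_of_isCompl {A : C} {P R : Formula A} (h : IsCompl P R) : P.neg = R := by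
  have disj {T : C} (t : T ⟶ A) (hP : P.Factors t) (hR : R.Factors t) : Nonempty (T ⟶ ⊥_ C) :=
    eq_bot_iff_factors.1 h.inf_eq_bot t ((Subobject.inf_factors t).2 ⟨hP, hR⟩)
  refine eq_iff_factors.2 fun T t => ?_
  rw [neg_factors_iff]
  constructor
  · intro hn
    refine factors_of_sup_eq_top h.sup_eq_top t t (fun S s hs => ?_) (fun _ _ => id)
    exact factors_of_hom_initial (hn s hs).some _ _
  · exact fun hR S s hs => disj _ hs (Subobject.factors_of_factors_right s hR)

/-! ### Coproducts of disjoint subobjects -/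

/-- Both injections factor through the join; the copairing of these factorizations splits its
inclusion. -/
theorem mk_inl_sup_mk_inr (A B : C) [Mono (coprod.inl : A ⟶ A ⨿ B)]
    [Mono (coprod.inr : B ⟶ A ⨿ B)] :
    Subobject.mk (coprod.inl : A ⟶ A ⨿ B) ⊔ Subobject.mk (coprod.inr : B ⟶ A ⨿ B) = ⊤ := by
  obtain ⟨s, hs⟩ := (factors_iff_exists _ _).1 (Subobject.factors_of_le _
    (le_sup_left (b := Subobject.mk (coprod.inr : B ⟶ A ⨿ B)))
    (Subobject.mk_factors_self (coprod.inl : A ⟶ A ⨿ B)))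
  obtain ⟨r, hr⟩ := (factors_iff_exists _ _).1 (Subobject.factors_of_le _
    (le_sup_right (a := Subobject.mk (coprod.inl : A ⟶ A ⨿ B)))
    (Subobject.mk_factors_self (coprod.inr : B ⟶ A ⨿ B)))
  rw [eq_top_iff_factors_id, factors_iff_exists]
  exact ⟨coprod.desc s r, by ext <;> simp [hs, hr]⟩

/-- Split according to the summands in which the two elements lie. In the same summand, cancel `m`
or `n`; in different ones, disjointness makes the stage initial, where all arrows agree. -/
theorem mono_coprod_desc {A B D : C} (m : A ⟶ D) (n : B ⟶ D) [Mono m] [Mono n]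
    (disj : ∀ ⦃T : C⦄ (a : T ⟶ A) (b : T ⟶ B), a ≫ m = b ≫ n → Nonempty (T ⟶ ⊥_ C)) :
    Mono (coprod.desc m n) where
  right_cancellation {T} f g h := by
    have : Mono (coprod.inl : A ⟶ A ⨿ B) := mono_of_mono_fac (coprod.inl_desc m n)
    have : Mono (coprod.inr : B ⟶ A ⨿ B) := mono_of_mono_fac (coprod.inr_desc m n)
    have cover := mk_inl_sup_mk_inr A B
    refine eq_of_sup_eq_top cover f (fun S s hs => eq_of_sup_eq_top cover (s ≫ g) ?_ ?_)
      (fun S s hs => eq_of_sup_eq_top cover (s ≫ g) ?_ ?_) <;> intro R r hr <;>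
      obtain ⟨a, ha⟩ := hs <;> obtain ⟨b, hb⟩ := hr <;>
      have key : r ≫ (s ≫ f) ≫ coprod.desc m n = (r ≫ s ≫ g) ≫ coprod.desc m n := by
        simp [h]
    all_goals
      dsimp at a b ha hb
      rw [← ha, ← hb] at key
      simp only [Category.assoc, coprod.inl_desc, coprod.inr_desc] at key
    · rw [← ha, ← hb, ← Category.assoc, (cancel_mono m).1 ((Category.assoc _ _ _).trans key)]
    · exact eq_of_hom_initial (disj _ _ ((Category.assoc _ _ _).trans key)).some _ _
    · exact eq_of_hom_initial (disj _ _ (((Category.assoc _ _ _).trans key).symm)).some _ _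
    · rw [← ha, ← hb, ← Category.assoc, (cancel_mono n).1 ((Category.assoc _ _ _).trans key)]

/-! ### The object `two` -/

instance mono_of_unit {A : C} (f : 𝟙_ C ⟶ A) : Mono f where
  right_cancellation _ _ _ := Subsingleton.elim _ _

variable (C) in
/-- The first injection into `two`. -/
def two.inl : 𝟙_ C ⟶ two C := coprod.inl

variable (C) in
/-- The second injection into `two`. -/
def two.inr : 𝟙_ C ⟶ two C := coprod.inr

theorem mk_two_inl_sup : Subobject.mk (two.inl C) ⊔ Subobject.mk (two.inr C) = ⊤ :=
  mk_inl_sup_mk_inr _ _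

theorem mk_unit_factors_iff {A T : C} (f : 𝟙_ C ⟶ A) (t : T ⟶ A) :
    (Subobject.mk f).Factors t ↔ t = toUnit T ≫ f := by
  rw [mk_factors_iff_exists]
  exact ⟨fun ⟨s, h⟩ => by rw [← h, toUnit_unique s], fun h => ⟨_, h.symm⟩⟩

theorem comp_chi_top {A B : C} (f : A ⟶ B) :
    f ≫ χ (⊤ : Subobject B).arrow = χ (⊤ : Subobject A).arrow := by
  rw [comp_chi_arrow, Subobject.pullback_top]

theorem pullback_bot {A B : C} (f : A ⟶ B) : (Subobject.pullback f).obj ⊥ = ⊥ :=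
  eq_iff_factors.2 fun T t => by rw [pullback_factors_iff, bot_factors_iff, bot_factors_iff]

theorem comp_chi_bot {A B : C} (f : A ⟶ B) :
    f ≫ χ (⊥ : Subobject B).arrow = χ (⊥ : Subobject A).arrow := by
  rw [comp_chi_arrow, pullback_bot]

variable (C) in
/-- The inclusion of `two` into `Ω`. -/
def twoToΩ : two C ⟶ Ω C :=
  coprod.desc (χ (⊤ : Subobject (𝟙_ C)).arrow) (χ (⊥ : Subobject (𝟙_ C)).arrow)

theorem inl_twoToΩ : two.inl C ≫ twoToΩ C = χ (⊤ : Subobject (𝟙_ C)).arrow :=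
  coprod.inl_desc _ _

theorem inr_twoToΩ : two.inr C ≫ twoToΩ C = χ (⊥ : Subobject (𝟙_ C)).arrow :=
  coprod.inr_desc _ _

theorem hom_initial_of_chi_top_eq_chi_bot {T : C}
    (h : χ (⊤ : Subobject T).arrow = χ (⊥ : Subobject T).arrow) : Nonempty (T ⟶ ⊥_ C) :=
  (bot_factors_iff (𝟙 T)).1 (chi_arrow_injective h ▸ Subobject.top_factors (𝟙 T))

instance : Mono (twoToΩ C) :=
  mono_coprod_desc _ _ fun T a b h => hom_initial_of_chi_top_eq_chi_bot (by
    rwa [comp_chi_top, comp_chi_bot] at h)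

theorem two_disjoint {T : C} (h : toUnit T ≫ two.inl C = toUnit T ≫ two.inr C) :
    Nonempty (T ⟶ ⊥_ C) := by
  have := h =≫ twoToΩ C
  simp only [Category.assoc, inl_twoToΩ, inr_twoToΩ, comp_chi_top, comp_chi_bot] at this
  exact hom_initial_of_chi_top_eq_chi_bot this

theorem chi_top_of_factors {A T : C} {P : Subobject A} {t : T ⟶ A} (h : P.Factors t) :
    t ≫ χ P.arrow = χ (⊤ : Subobject T).arrow := by
  have : (Subobject.pullback t).obj P = ⊤ := by
    rwa [eq_top_iff_factors_id, pullback_factors_iff, Category.id_comp]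
  rw [comp_chi_arrow, this]

theorem chi_bot_of_neg_factors {A T : C} {P : Formula A} {t : T ⟶ A} (h : P.neg.Factors t) :
    t ≫ χ P.arrow = χ (⊥ : Subobject T).arrow := by
  have : (Subobject.pullback t).obj P = ⊥ := by
    rw [eq_bot_iff_factors]
    intro S s hs
    rw [pullback_factors_iff] at hs
    exact (neg_factors_iff P t).1 h s hs
  rw [comp_chi_arrow, this]

/-- The arrow to `two` defined by a complemented subobject. -/
theorem exists_hom_two {X : C} (W : Formula X) (hW : W ⊔ W.neg = ⊤) :
    ∃ h : X ⟶ two C, (∀ ⦃T : C⦄ (x : T ⟶ X), W.Factors x → x ≫ h = toUnit T ≫ two.inl C) ∧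
      (∀ ⦃T : C⦄ (x : T ⟶ X), W.neg.Factors x → x ≫ h = toUnit T ≫ two.inr C) := by
  have inl {T : C} (x : T ⟶ X) (hx : W.Factors x) :
      (toUnit T ≫ two.inl C) ≫ twoToΩ C = x ≫ χ W.arrow := by
    rw [Category.assoc, inl_twoToΩ, comp_chi_top, chi_top_of_factors hx]
  have inr {T : C} (x : T ⟶ X) (hx : W.neg.Factors x) :
      (toUnit T ≫ two.inr C) ≫ twoToΩ C = x ≫ χ W.arrow := by
    rw [Category.assoc, inr_twoToΩ, comp_chi_bot, chi_bot_of_neg_factors hx]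
  -- The characteristic map of `W` is constantly true on `W` and constantly false on its complement;
  -- since these cover `X`, it lands in `two C` inside `Ω C`.
  have : (Subobject.mk (twoToΩ C)).Factors (χ W.arrow) := by
    refine factors_of_sup_eq_top hW (𝟙 X) _ (fun S s hs => ?_) (fun S s hs => ?_) <;>
      rw [Category.comp_id] at hs
    exacts [⟨_, inl s hs⟩, ⟨_, inr s hs⟩]
  obtain ⟨h, hh⟩ := this
  dsimp at h hh
  refine ⟨h, fun T x hx => ?_, fun T x hx => ?_⟩ <;> rw [← cancel_mono (twoToΩ C)]
  · rw [inl x hx, Category.assoc, hh]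
  · rw [inr x hx, Category.assoc, hh]

variable (C) in
/-- The arrow exchanging the two summands of `two`. -/
def two.not : two C ⟶ two C := coprod.desc (two.inr C) (two.inl C)

theorem two.inl_not : two.inl C ≫ two.not C = two.inr C := coprod.inl_desc _ _

theorem two.inr_not : two.inr C ≫ two.not C = two.inl C := coprod.inr_desc _ _

theorem two_cases {B T : C} (x : T ⟶ two C) {D : Subobject B} (t : T ⟶ B)
    (hl : ∀ ⦃S : C⦄ (s : S ⟶ T), s ≫ x = toUnit S ≫ two.inl C → D.Factors (s ≫ t))
    (hr : ∀ ⦃S : C⦄ (s : S ⟶ T), s ≫ x = toUnit S ≫ two.inr C → D.Factors (s ≫ t)) :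
    D.Factors t :=
  factors_of_sup_eq_top mk_two_inl_sup x t
    (fun _ s hs => hl s ((mk_unit_factors_iff _ _).1 hs))
    (fun _ s hs => hr s ((mk_unit_factors_iff _ _).1 hs))

/-- The complement of the diagonal is the graph of the exchange `two.not`, as checked on the four
pairs of summands. -/
theorem isDecidable_two : IsDecidable (two C) := by
  refine ⟨Subobject.mk (lift (𝟙 _) (two.not C)), IsCompl.of_eq ?_ ?_⟩
  · refine eq_bot_iff_factors.2 fun T t => ?_
    obtain ⟨a, b, rfl⟩ : ∃ a b, t = lift a b := ⟨t ≫ fst _ _, t ≫ snd _ _, by simp⟩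
    rw [Subobject.inf_factors, mk_graph_factors_iff, mk_graph_factors_iff]
    rintro ⟨h, h'⟩
    rw [Category.comp_id] at h
    subst h
    refine (bot_factors_iff (𝟙 T)).1 (two_cases a _ ?_ ?_) <;> intro S s hs <;>
      rw [bot_factors_iff] <;> have e := s ≫= h' <;> rw [← Category.assoc, hs, Category.assoc] at e
    · exact two_disjoint (by rw [← e, two.inl_not])
    · exact two_disjoint (by rw [← e, two.inr_not])
  · refine eq_top_iff_factors.2 fun T t => ?_
    refine two_cases (t ≫ fst _ _) _ (fun S s hs => two_cases (s ≫ t ≫ snd _ _) _ ?_ ?_)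
      (fun S s hs => two_cases (s ≫ t ≫ snd _ _) _ ?_ ?_) <;> intro R r hr
    all_goals
      have e : r ≫ s ≫ t = lift (r ≫ s ≫ t ≫ fst _ _) (r ≫ s ≫ t ≫ snd _ _) := by
        apply CartesianMonoidalCategory.hom_ext <;> simp
      rw [e, hr, hs, ← Category.assoc, toUnit_unique (r ≫ toUnit S) (toUnit R)]
    · exact Subobject.sup_factors_of_factors_left ((mk_graph_factors_iff _ _ _).2 (by simp))
    · exact Subobject.sup_factors_of_factors_right
        ((mk_graph_factors_iff _ _ _).2 (by simp [two.inl_not]))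
    · exact Subobject.sup_factors_of_factors_right
        ((mk_graph_factors_iff _ _ _).2 (by simp [two.inr_not]))
    · exact Subobject.sup_factors_of_factors_left ((mk_graph_factors_iff _ _ _).2 (by simp))

/-! ### Epimorphisms -/

/-- If `u` and `v` agree on the pullback, then `B` and its part `E` where `u = v` have the same
inverse image along `q`. Cancelling `q` in front of characteristic maps gives `E = B`. -/
theorem epi_pullback_snd_of_mono {X Q B : C} (q : X ⟶ Q) [Epi q] (m : B ⟶ Q) [Mono m] :
    Epi (pullback.snd q m) where
  left_cancellation {Z} u v h := by
    let E : Subobject Q := Subobject.mk (equalizer.ι u v ≫ m)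
    have hE : χ E.arrow = χ (Subobject.mk m).arrow := by
      rw [← cancel_epi q, comp_chi_arrow, comp_chi_arrow]
      suffices e : (Subobject.pullback q).obj E = (Subobject.pullback q).obj (.mk m) by rw [e]
      refine eq_iff_factors.2 fun T x => ?_
      simp only [pullback_factors_iff, E, mk_factors_iff_exists]
      constructor
      · rintro ⟨s, hs⟩
        exact ⟨s ≫ equalizer.ι u v, by simpa using hs⟩
      · rintro ⟨b, hb⟩
        have hb' : b ≫ u = b ≫ v := by
          rw [← pullback.lift_snd x b hb.symm, Category.assoc, h, Category.assoc]
        exact ⟨equalizer.lift b hb', by rw [equalizer.lift_ι_assoc, hb]⟩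
    have : E.Factors m := chi_arrow_injective hE ▸ Subobject.mk_factors_self m
    obtain ⟨s, hs⟩ := (mk_factors_iff_exists _ _).1 this
    rw [← Category.assoc] at hs
    have hs : s ≫ equalizer.ι u v = 𝟙 B := (cancel_mono m).1 (hs.trans (Category.id_comp m).symm)
    rw [← Category.id_comp u, ← Category.id_comp v, ← hs, Category.assoc, equalizer.condition,
      Category.assoc]

/-- Generalized elements lift locally along an epimorphism. -/
theorem exists_epi_lift {X Q T : C} (q : X ⟶ Q) [Epi q] (g : T ⟶ Q) :
    ∃ (T' : C) (p : T' ⟶ T) (x : T' ⟶ X), Epi p ∧ x ≫ q = p ≫ g := by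
  -- Pulling `q` back along `g` amounts to pulling `T ◁ q` back along the graph of `g`, which is
  -- mono. Being a left adjoint, `tensorLeft T` preserves epimorphisms.
  have : Epi (T ◁ q) := inferInstanceAs (Epi ((tensorLeft T).map q))
  refine ⟨pullback (T ◁ q) (lift (𝟙 T) g), pullback.snd _ _, pullback.fst _ _ ≫ snd _ _,
    epi_pullback_snd_of_mono _ _, ?_⟩
  simpa using pullback.condition (f := T ◁ q) (g := lift (𝟙 T) g) =≫ snd _ _

/-- Every epimorphism is the coequalizer of its kernel pair. -/
theorem exists_factor_of_epi {X Q Y : C} (q : X ⟶ Q) [Epi q] (f : X ⟶ Y)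
    (h : ∀ ⦃T : C⦄ (a b : T ⟶ X), a ≫ q = b ≫ q → a ≫ f = b ≫ f) :
    ∃ f' : Q ⟶ Y, q ≫ f' = f := by
  -- The image of `(q, f)` in `Q ⊗ Y` is the graph of the desired arrow. Its projection to `Q` is
  -- epi because `q` is; it is mono because elements of the image lift locally to `X`, where `h`
  -- applies.
  let e := factorThruImage (lift q f)
  let i := image.ι (lift q f)
  have he : e ≫ i = lift q f := image.fac _
  have hq : e ≫ i ≫ fst _ _ = q := by rw [← Category.assoc, he, lift_fst]
  have hf : e ≫ i ≫ snd _ _ = f := by rw [← Category.assoc, he, lift_snd]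
  have : Epi (i ≫ fst _ _) := epi_of_epi_fac hq
  have : Mono (i ≫ fst _ _) := ⟨fun {T} a b hab => by
    obtain ⟨T₁, p₁, x₁, _, h₁⟩ := exists_epi_lift e a
    obtain ⟨T₂, p₂, x₂, _, h₂⟩ := exists_epi_lift e (p₁ ≫ b)
    have hx : (p₂ ≫ x₁) ≫ q = x₂ ≫ q := by
      rw [← hq, ← Category.assoc x₂, h₂, Category.assoc, ← Category.assoc x₁, h₁]
      simp only [Category.assoc] at hab ⊢
      rw [hab]
    rw [← cancel_epi p₁, ← cancel_epi p₂, ← h₁, ← h₂, ← cancel_mono i]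
    simp only [Category.assoc, he, comp_lift]
    simpa only [Category.assoc] using congrArg₂ lift hx (h _ _ hx)⟩
  have := isIso_of_mono_of_epi (i ≫ fst Q Y)
  refine ⟨inv (i ≫ fst _ _) ≫ i ≫ snd _ _, ?_⟩
  calc q ≫ inv (i ≫ fst _ _) ≫ i ≫ snd _ _
      = e ≫ (i ≫ fst _ _) ≫ inv (i ≫ fst _ _) ≫ i ≫ snd _ _ := by
        rw [← Category.assoc e, hq]
    _ = f := by rw [IsIso.hom_inv_id_assoc, hf]

/-! ### The internal language -/

/-- The membership relation. -/
def elem (X : C) : Subobject (X ⊗ Pow X) := sub ((ihom.ev X).app (Ω C))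

theorem memF_factors_iff {Γ X T : C} (t : Γ ⟶ X) (u : Γ ⟶ Pow X) (s : T ⟶ Γ) :
    (memF t u).Factors s ↔ (elem X).Factors (lift (s ≫ t) (s ≫ u)) := by
  rw [memF, sub_factors_iff, elem, sub_factors_iff _ (lift _ _), ← comp_lift_assoc]

theorem elem_setOfT_factors_iff {Γ X T : C} (φ : Formula (X ⊗ Γ)) (x : T ⟶ X) (s : T ⟶ Γ) :
    (elem X).Factors (lift x (s ≫ setOfT φ)) ↔ φ.Factors (lift x s) := by
  have h : lift x (s ≫ setOfT φ) ≫ (ihom.ev X).app (Ω C) = lift x s ≫ χ φ.arrow := by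
    rw [← lift_whiskerLeft, Category.assoc, ← MonoidalClosed.uncurry_eq, setOfT,
      MonoidalClosed.uncurry_curry]
  rw [elem, sub_factors_iff, h, ← sub_factors_iff, sub_chi]

theorem memF_setOfT_factors_iff {Γ X T : C} (φ : Formula (X ⊗ Γ)) (s : T ⟶ X ⊗ Γ) :
    (memF (fst X Γ) (snd X Γ ≫ setOfT φ)).Factors s ↔ φ.Factors s := by
  rw [memF_factors_iff, ← Category.assoc s, elem_setOfT_factors_iff]
  simp

theorem eqF_setOfT_factors_iff {Γ X T : C} (φ ψ : Formula (X ⊗ Γ)) (s : T ⟶ Γ) :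
    (eqF (setOfT φ) (setOfT ψ)).Factors s ↔ ∀ ⦃S : C⦄ (x : S ⟶ X) (t : S ⟶ T),
      φ.Factors (lift x (t ≫ s)) ↔ ψ.Factors (lift x (t ≫ s)) := by
  rw [eqF, equalizerSubobject_factors_iff, setOfT, setOfT, ← MonoidalClosed.curry_natural_left,
    ← MonoidalClosed.curry_natural_left, MonoidalClosed.curry_injective.eq_iff, comp_chi_arrow,
    comp_chi_arrow]
  constructor
  · intro h S x t
    simpa [pullback_factors_iff] using eq_iff_factors.1 (chi_arrow_injective h) (lift x t)
  · intro h
    suffices e : (Subobject.pullback (X ◁ s)).obj φ = (Subobject.pullback (X ◁ s)).obj ψ by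
      rw [e]
    refine eq_iff_factors.2 fun S r => ?_
    obtain ⟨x, t, rfl⟩ : ∃ x t, r = lift x t := ⟨r ≫ fst _ _, r ≫ snd _ _, by simp⟩
    simpa [pullback_factors_iff] using h x t

/-- The subobject of `X` named by a global element of `Pow X`. -/
def named {X : C} (w : 𝟙_ C ⟶ Pow X) : Subobject X :=
  (Subobject.pullback (lift (𝟙 X) (toUnit X ≫ w))).obj (elem X)

theorem elem_factors_iff_named {X T : C} (w : 𝟙_ C ⟶ Pow X) (x : T ⟶ X) :
    (elem X).Factors (lift x (toUnit T ≫ w)) ↔ (named w).Factors x := by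
  simp [named, pullback_factors_iff]

theorem exists_named_eq {X : C} (W : Subobject X) : ∃ w : 𝟙_ C ⟶ Pow X, named w = W := by
  refine ⟨setOfT ((Subobject.pullback (fst X (𝟙_ C))).obj W), eq_iff_factors.2 fun T x => ?_⟩
  rw [← elem_factors_iff_named, elem_setOfT_factors_iff, pullback_factors_iff, lift_fst]

/-- At global elements, the variable `w` of type `powCompl X` thus ranges over the external
complemented subobjects of `X`. -/
theorem powCompl_factors_iff {X : C} (w : 𝟙_ C ⟶ Pow X) :
    (powCompl X).Factors w ↔ named w ⊔ Formula.neg (named w) = ⊤ := by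
  let M : Formula (X ⊗ Pow X) := memF (fst X _) (snd X _ ≫ 𝟙 (Pow X))
  have hM : M ⊔ memF (fst X _) (snd X _ ≫ complT (𝟙 (Pow X))) = M ⊔ M.neg :=
    congrArg _ (eq_iff_factors.2 fun T t => memF_setOfT_factors_iff _ _)
  have hW : named w = (Subobject.pullback (lift (𝟙 X) (toUnit X ≫ w))).obj M :=
    eq_iff_factors.2 fun T t => by
      rw [← elem_factors_iff_named, pullback_factors_iff, memF_factors_iff]
      simp
  have e {S : C} (x : S ⟶ X) (t : S ⟶ 𝟙_ C) :
      lift x (t ≫ w) = x ≫ lift (𝟙 X) (toUnit X ≫ w) := by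
    simp [toUnit_unique t (toUnit S)]
  rw [powCompl, unionT, univT, eqF_setOfT_factors_iff, hM, hW, ← pullback_neg, ← pullback_sup,
    eq_top_iff_factors]
  refine ⟨fun h T x => ?_, fun h S x t => ⟨fun _ => Subobject.top_factors _, fun _ => ?_⟩⟩
  · rw [pullback_factors_iff, ← e x (toUnit T)]
    exact (h x (toUnit T)).2 (Subobject.top_factors _)
  · rw [e, ← pullback_factors_iff]
    exact h x

theorem fiber_inter_eq_empty_factors_iff {Γ X Y : C} (f : X ⟶ Y) (y : Γ ⟶ Y) (u : Γ ⟶ Pow X)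
    (s : 𝟙_ C ⟶ Γ) :
    (eqF (interT (fiberT f y) u) (emptyT Γ X)).Factors s ↔
      ∀ ⦃S : C⦄ (x : S ⟶ X), x ≫ f = toUnit S ≫ s ≫ y → (named (s ≫ u)).Factors x →
        Nonempty (S ⟶ ⊥_ C) := by
  rw [interT, emptyT, eqF_setOfT_factors_iff]
  have e {S : C} (x : S ⟶ X) (t : S ⟶ 𝟙_ C) :
      (memF (fst X Γ) (snd X Γ ≫ fiberT f y) ⊓ memF (fst X Γ) (snd X Γ ≫ u)).Factors
        (lift x (t ≫ s)) ↔ x ≫ f = toUnit S ≫ s ≫ y ∧ (named (s ≫ u)).Factors x := by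
    rw [Subobject.inf_factors, fiberT, memF_setOfT_factors_iff, memF_factors_iff,
      pullback_factors_iff, graph, ← elem_factors_iff_named, toUnit_unique t (toUnit S), comp_lift,
      mk_graph_factors_iff]
    simp only [lift_fst, lift_snd_assoc, Category.assoc]
  simp only [e, bot_factors_iff]
  exact ⟨fun h S x hx hw => (h x (toUnit S)).1 ⟨hx, hw⟩, fun h S x _ =>
    ⟨fun hx => h x hx.1 hx.2, fun ⟨i⟩ => ⟨eq_of_hom_initial i _ _, factors_of_hom_initial i _ _⟩⟩⟩

theorem named_complT {Γ X : C} (u : Γ ⟶ Pow X) (s : 𝟙_ C ⟶ Γ) :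
    named (s ≫ complT u) = Formula.neg (named (s ≫ u)) := by
  refine eq_iff_factors.2 fun T x => ?_
  rw [← elem_factors_iff_named, complT, ← Category.assoc, elem_setOfT_factors_iff,
    neg_factors_iff, neg_factors_iff]
  simp only [memF_factors_iff, ← elem_factors_iff_named]
  simp

/-! ### Consequences of the Nullstellensatz -/

theorem Nullstellensatz.hom_initial_or (h : Nullstellensatz C) (A : C) :
    Nonempty (A ⟶ ⊥_ C) ∨ Nonempty (𝟙_ C ⟶ A) :=
  (h A).imp_left fun ⟨i⟩ => ⟨i.to _⟩

/-- Apply NS to the subobject of `1` obtained by pulling `P` back along `t`: if it is initial the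
negation holds, and a point of it shows that `P` holds. -/
theorem Nullstellensatz.factors_or_neg_factors (h : Nullstellensatz C) {A : C} (P : Formula A)
    (t : 𝟙_ C ⟶ A) : P.Factors t ∨ P.neg.Factors t := by
  rcases h.hom_initial_or ((Subobject.pullback t).obj P : C) with ⟨⟨i⟩⟩ | ⟨⟨x⟩⟩
  · right
    rw [neg_factors_iff]
    intro S s hs
    rw [← pullback_factors_iff, factors_iff_exists] at hs
    exact ⟨hs.choose ≫ i⟩
  · left
    have := Subobject.factors_comp_arrow (P := (Subobject.pullback t).obj P) x
    rwa [pullback_factors_iff, toUnit_unique (x ≫ _) (𝟙 _), Category.id_comp] at this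

theorem Nullstellensatz.sup_factors_iff (h : Nullstellensatz C) {A : C} (P R : Formula A)
    (t : 𝟙_ C ⟶ A) : (P ⊔ R).Factors t ↔ P.Factors t ∨ R.Factors t := by
  refine ⟨fun ht => ?_, fun ht => ht.elim Subobject.sup_factors_of_factors_left
    Subobject.sup_factors_of_factors_right⟩
  refine (h.factors_or_neg_factors P t).imp_right fun hP => ?_
  rw [ToposFibers.sup_factors_iff] at ht
  rw [← Category.id_comp t]
  refine factors_of_sup_eq_top ht (𝟙 _) _ (fun S s hs => ?_) (fun S s hs => ?_) <;>
    rw [pullback_factors_iff, Category.comp_id] at hs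
  · exact factors_of_hom_initial ((neg_factors_iff P t).1 hP s hs).some _ _
  · rwa [Category.id_comp]

/-- A stage forcing `¬P` can have no global element if `P` holds at all of them (unless the topos is
degenerate), so NS makes it initial. Conversely, excluded middle at a point removes the double
negation. -/
theorem Nullstellensatz.neg_neg_valid_iff (h : Nullstellensatz C) {A : C} (P : Formula A) :
    P.neg.neg.Valid ↔ ∀ t : 𝟙_ C ⟶ A, P.Factors t := by
  rw [Formula.Valid, eq_top_iff_factors]
  constructor
  · intro hP t
    refine (h.factors_or_neg_factors P t).elim id fun ht => ?_
    exact factors_of_hom_initial ((neg_factors_iff _ _).1 (hP t) (𝟙 _)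
      (by rwa [Category.id_comp])).some _ _
  · intro hP T t
    rw [neg_factors_iff]
    intro S s hs
    refine (h.hom_initial_or S).elim id fun ⟨x⟩ => ?_
    exact ((neg_factors_iff _ _).1 hs x (hP _)).map (toUnit S ≫ ·)

/-- External description of pneumoconnected fibers: a fiber over a global element meets only one
side of a complemented subobject. -/
theorem Nullstellensatz.pneumoconnectedFibers_iff (h : Nullstellensatz C) {X Y : C} (f : X ⟶ Y) :
    PneumoconnectedFibers f ↔ ∀ (y : 𝟙_ C ⟶ Y) (W : Formula X), W ⊔ W.neg = ⊤ →
      (∀ ⦃S : C⦄ (x : S ⟶ X), x ≫ f = toUnit S ≫ y → W.Factors x → Nonempty (S ⟶ ⊥_ C)) ∨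
      (∀ ⦃S : C⦄ (x : S ⟶ X), x ≫ f = toUnit S ≫ y → W.neg.Factors x →
        Nonempty (S ⟶ ⊥_ C)) := by
  rw [PneumoconnectedFibers, h.neg_neg_valid_iff]
  simp only [h.sup_factors_iff, fiber_inter_eq_empty_factors_iff, named_complT]
  constructor
  · intro H y W hW
    obtain ⟨w, rfl⟩ := exists_named_eq W
    obtain ⟨w', rfl⟩ := (factors_iff_exists _ _).1 ((powCompl_factors_iff w).2 hW)
    simpa only [lift_fst, lift_snd_assoc] using H (lift y w')
  · intro H t
    refine H (t ≫ fst _ _) _ ((powCompl_factors_iff _).1 ?_)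
    rw [← Category.assoc]
    exact Subobject.factors_comp_arrow _

theorem Nullstellensatz.pneumoconnectedFibers_of_factor (h : Nullstellensatz C) {X Q : C}
    (q : X ⟶ Q) (H : ∀ f : X ⟶ two C, ∃ f' : Q ⟶ two C, q ≫ f' = f) :
    PneumoconnectedFibers q := by
  rw [h.pneumoconnectedFibers_iff]
  intro y W hW
  obtain ⟨f, hl, hr⟩ := exists_hom_two W hW
  obtain ⟨g, rfl⟩ := H f
  have hy : (Subobject.mk (two.inl C) ⊔ Subobject.mk (two.inr C)).Factors (y ≫ g) :=
    mk_two_inl_sup (C := C) ▸ Subobject.top_factors _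
  have comp {S : C} (x : S ⟶ X) (hx : x ≫ q = toUnit S ≫ y) {i : 𝟙_ C ⟶ two C}
      (hi : y ≫ g = toUnit (𝟙_ C) ≫ i) : x ≫ q ≫ g = toUnit S ≫ i := by
    rw [← Category.assoc, hx, Category.assoc, hi, ← Category.assoc, toUnit_unique (_ ≫ _)]
  rw [h.sup_factors_iff, mk_unit_factors_iff, mk_unit_factors_iff] at hy
  -- The order is reversed because the value `two.inr` at `y` is what keeps the fiber off `W`, and
  -- `two.inl` what keeps it off the complement.
  refine hy.symm.imp (fun hy S x hx hw => two_disjoint ?_) (fun hy S x hx hw => two_disjoint ?_)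
  · rw [← hl x hw, comp x hx hy]
  · rw [← hr x hw, comp x hx hy]

theorem Nullstellensatz.exists_factor_of_pneumoconnectedFibers (h : Nullstellensatz C) {X Q : C}
    (q : X ⟶ Q) [Epi q] (H : PneumoconnectedFibers q) {Y : C} (hY : IsDecidable Y) (f : X ⟶ Y) :
    ∃ f' : Q ⟶ Y, q ≫ f' = f := by
  rw [h.pneumoconnectedFibers_iff] at H
  obtain ⟨D, hD⟩ := hY
  have hΔ : Formula.neg (Subobject.mk (lift (𝟙 Y) (𝟙 Y))) = D := neg_eq_of_isCompl hD
  subst hΔ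
  have disj ⦃x₁ x₂ : 𝟙_ C ⟶ X⦄ (hq : x₁ ≫ q = x₂ ≫ q)
      (hn : (Formula.neg (Subobject.mk (lift (𝟙 Y) (𝟙 Y)))).Factors (lift (x₁ ≫ f) (x₂ ≫ f))) :
      Nonempty (𝟙_ C ⟶ ⊥_ C) := by
    -- Pulling the diagonal back along `k` gives `{x | f x = f x₁}`, complemented because the
    -- diagonal is. It contains `x₁` and its complement contains `x₂`, though both lie in one fiber.
    let k : X ⟶ Y ⊗ Y := lift (toUnit X ≫ x₁ ≫ f) f
    have hk (x : 𝟙_ C ⟶ X) : x ≫ k = lift (x₁ ≫ f) (x ≫ f) := by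
      rw [comp_lift, ← Category.assoc, toUnit_unique (x ≫ _) (𝟙 _), Category.id_comp]
    rcases H (x₁ ≫ q) ((Subobject.pullback k).obj (.mk (lift (𝟙 Y) (𝟙 Y))))
      (by rw [← pullback_neg, ← pullback_sup, hD.sup_eq_top, Subobject.pullback_top]) with H | H
    · refine H x₁ (by rw [toUnit_unique (toUnit _) (𝟙 _), Category.id_comp]) ?_
      rw [pullback_factors_iff, hk, mk_graph_factors_iff, Category.comp_id]
    · refine H x₂ (by rw [toUnit_unique (toUnit _) (𝟙 _), Category.id_comp, hq]) ?_
      rwa [← pullback_neg, pullback_factors_iff, hk]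
  refine exists_factor_of_epi q f fun T a b hab => ?_
  have : (Subobject.mk (lift (𝟙 Y) (𝟙 Y))).Factors (lift (a ≫ f) (b ≫ f)) := by
    refine factors_of_sup_eq_top hD.sup_eq_top (lift (a ≫ f) (b ≫ f)) _ (fun _ _ => id)
      fun S s hs => ?_
    -- On `S` the values of `f` at `a` and `b` differ. A global element of `S` turns this into two
    -- points of one fiber, and `disj` then collapses the topos.
    rcases h.hom_initial_or S with ⟨⟨i⟩⟩ | ⟨⟨x⟩⟩
    · exact factors_of_hom_initial i _ _
    · obtain ⟨i⟩ := disj (x₁ := x ≫ s ≫ a) (x₂ := x ≫ s ≫ b) (by simp only [Category.assoc, hab])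
        (by simpa using Subobject.factors_of_factors_right x hs)
      exact factors_of_hom_initial (toUnit S ≫ i) _ _
  rwa [mk_graph_factors_iff, Category.comp_id] at this

end

end ToposFibers

theorem theoremT {C : Type u} [Category.{v} C] [HasFiniteLimits C] [CartesianMonoidalCategory C]
    [MonoidalClosed C] [HasSubobjectClassifier C] (hNS : ToposFibers.Nullstellensatz C)
    {X Q : C} (q : X ⟶ Q) [Epi q] :
    List.TFAE
      [∀ f : X ⟶ ToposFibers.two C, ∃ f' : Q ⟶ ToposFibers.two C, q ≫ f' = f,
        ToposFibers.PneumoconnectedFibers q,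
        ∀ Y : C, ToposFibers.IsDecidable Y → ∀ f : X ⟶ Y, ∃ f' : Q ⟶ Y, q ≫ f' = f] := by
  tfae_have 1 → 2 := hNS.pneumoconnectedFibers_of_factor q
  tfae_have 2 → 3 := fun h _ hY => hNS.exists_factor_of_pneumoconnectedFibers q h hY
  tfae_have 3 → 1 := fun h => h _ ToposFibers.isDecidable_two
  tfae_finish
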